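/- Let $(X_n)_{n\ge 1}$ be a random completely multiplicative function (that is, $X_{mn}=X_mX_n$ for all $m,n\ge 1$) such that the variables $(X_p)_{p\text{ prime}}$ are independent and uniformly distributed on the unit circle $\mathbb U=\{z\in\mathbb C:|z|=1\}$. Fix an integer $k\ge 1$. For $N\ge 1$ let $$\mu_{k,N}:=\frac1N\sum_{n=1}^N\delta_{(X_{n+1},\dots,X_{n+k})}$$ be the empirical measure of the first $N$ $k$-tuples of consecutive values, and let $\mu_k$ be the uniform probability measure on $\mathbb U^k$. For a continuous function $f:\mathbb U^k\to\mathbb C$ and $m\in\mathbb Z^k$ let $$\hat f(m):=\int_{\mathbb U^k} f(z_1,\dots,z_k)\prod_{j=1}^k z_j^{-m_j}\,d\mu_k(z_1,\dots,z_k).$$ Then, almost surely, $\mu_{k,N}$ converges weakly to $\mu_k$ as $N\to\infty$. More precisely, the following holds with probability one: for all real $u>k/2$, for every norm $\|\cdot\|$ on $\mathbb R^k$, for all continuous functions $f:\mathbb U^k\to\mathbb C$ such that $$\sum_{m\in\mathbb Z^k}|\hat f(m)|\,\|m\|^u<\infty,$$ and for all $\varepsilon>0$, $$\int_{\mathbb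 U^k}f\,d\mu_{k,N}=\int_{\mathbb U^k}f\,d\mu_k+O\bigl(N^{-1/2+\varepsilon}\bigr)\qquad(N\to\infty),$$ where the constant in the $O$ may depend on everything except $N$. -/

import Mathlib

open MeasureTheory ProbabilityTheory Filter Topology Asymptotics

noncomputable section

instance Circle.instMeasurableSpaceBorel : MeasurableSpace Circle := borel Circle

instance Circle.instBorelSpaceBorel : BorelSpace Circle := ⟨rfl⟩

/-- The uniform probability measure on the unit circle: the Haar measure of total mass one. -/
def circleUniform : Measure Circle := Measure.haarMeasure ⊤

instance circleUniform.instIsProbabilityMeasure : IsProbabilityMeasure circleUniform :=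
  ⟨Measure.haarMeasure_self⟩

/-- The uniform probability measure on the `k`-dimensional torus `𝕌 ^ k`. -/
def torusUniform (k : ℕ) : Measure (Fin k → Circle) := Measure.pi fun _ => circleUniform

instance torusUniform.instIsProbabilityMeasure (k : ℕ) :
    IsProbabilityMeasure (torusUniform k) := by
  unfold torusUniform; infer_instance

/-- `X` is a random completely multiplicative function on the positive integers whose values at
the primes are i.i.d. and uniform on the unit circle. The value `X 0` plays no role. -/
structure IsUniformRandomMultiplicative {Ω : Type*} [MeasurableSpace Ω] (P : Measure Ω)
    (X : ℕ → Ω → Circle) : Prop where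
  measurable_prime : ∀ p : Nat.Primes, Measurable (X p)
  iIndepFun_prime : iIndepFun (fun p : Nat.Primes => X p) P
  map_prime : ∀ p : Nat.Primes, P.map (X p) = circleUniform
  map_mul : ∀ m n : ℕ, 1 ≤ m → 1 ≤ n → ∀ ω, X (m * n) ω = X m ω * X n ω

/-- The empirical measure `N⁻¹ ∑_{n = 1}^N δ_{(x (n + 1), …, x (n + k))}` of the first `N`
`k`-tuples of consecutive values of a sequence `x` (it is the zero measure for `N = 0`). -/
def empiricalMeasure (x : ℕ → Circle) (k N : ℕ) : Measure (Fin k → Circle) :=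
  (N : ENNReal)⁻¹ • ∑ n ∈ Finset.Icc 1 N, Measure.dirac fun j : Fin k => x (n + (j + 1))

theorem empiricalMeasure_apply_univ (x : ℕ → Circle) (k N : ℕ) (hN : 1 ≤ N) :
    empiricalMeasure x k N Set.univ = 1 := by
  have h0 : (N : ENNReal) ≠ 0 := by exact_mod_cast (by omega : N ≠ 0)
  simp [empiricalMeasure, ENNReal.inv_mul_cancel h0 (ENNReal.natCast_ne_top N)]

instance empiricalMeasure.instIsFiniteMeasure (x : ℕ → Circle) (k N : ℕ) :
    IsFiniteMeasure (empiricalMeasure x k N) := by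
  rcases Nat.eq_zero_or_pos N with rfl | hN
  · simp only [empiricalMeasure, Finset.Icc_eq_empty_of_lt Nat.zero_lt_one, Finset.sum_empty,
      smul_zero]
    infer_instance
  · exact ⟨by rw [empiricalMeasure_apply_univ x k N hN]; exact ENNReal.one_lt_top⟩

/-- The Fourier coefficient `∫ f(z) ∏ j, z_j ^ (-m_j)` over the torus with its uniform measure. -/
def torusFourierCoeff {k : ℕ} (f : (Fin k → Circle) → ℂ) (m : Fin k → ℤ) : ℂ :=
  ∫ z, f z * ((∏ j, z j ^ (-m j) : Circle) : ℂ) ∂(torusUniform k)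

end

/-!
For a nonzero frequency `m : Fin k → ℤ`, consider the sums
`S_N(m) = ∑_{n ≤ N} ∏_j X_{n+j+1} ^ m_j`. Everything follows from the second moment bound
`E |∑_{n ∈ I} ∏_j X_{n+j+1} ^ m_j|² ≤ k #I` for finite sets `I` of integers, which is uniform in `m`
(`IsUniformRandomMultiplicative.integral_norm_sum_sq_le`).

To see it, expand the square. By multiplicativity and independence, the correlation of the terms
`n` and `n'` vanishes unless the rational numbers `∏_j (n+j+1) ^ m_j` and `∏_j (n'+j+1) ^ m_j`
coincide. The logarithm of `x ↦ ∏_j (x+j+1) ^ m_j` has derivative `∑_j m_j / (x+j+1)`, whose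
numerator is a nonzero polynomial of degree less than `k`. By Rolle's theorem each value is thus
taken at most `k` times on `[0, ∞)` (`card_le_of_shiftedLogSum_eq`), so each `n` is correlated with at
most `k` values `n'`.

The Rademacher–Menshov inequality (`norm_sum_range_sq_le_dyadicSquareSum`) bounds all `|S_N(m)|²`
with `N < 2 ^ R` by a quantity of mean at most `k R² 2 ^ R`. For `2u > k` and `ε > 0` these means,
weighted by `‖m‖ ^ (-2u) 2 ^ (-R (1 + 2ε))`, are summable over `m` and `R`. Almost surely, therefore,
`|S_N(m)| ≤ C ‖m‖ ^ u N ^ (1/2 + ε)` for all `m ≠ 0` and `N ≥ 1`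
(`IsUniformRandomMultiplicative.ae_hasCharacterSumBound`); countably many pairs `(u, ε)` suffice.

The rest is deterministic. The rate follows by integrating the Fourier series of `f` term by term
(`isBigO_integral_sub_of_hasCharacterSumBound`), and weak convergence follows from the density of
trigonometric polynomials (`tendsto_integral_of_tendsto_integral_torusCharacter`).
-/

/-! ### Level sets of integral combinations of shifted logarithms -/

/-- The logarithm of the rational function `x ↦ ∏ j, (x + j + 1) ^ m j`. -/
noncomputable def shiftedLogSum {k : ℕ} (m : Fin k → ℤ) (x : ℝ) : ℝ :=
  ∑ j, (m j : ℝ) * Real.log (x + ((j : ℕ) + 1 : ℝ))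

/-- The numerator of the derivative `∑ j, m j / (x + j + 1)` of `shiftedLogSum m` over the common
denominator `∏ j, (x + j + 1)`. -/
noncomputable def shiftedLogSumDerivNumerator {k : ℕ} (m : Fin k → ℤ) : Polynomial ℝ :=
  ∑ j, Polynomial.C (m j : ℝ) *
    ∏ i ∈ Finset.univ.erase j, (Polynomial.X + Polynomial.C ((i : ℕ) + 1 : ℝ))

theorem hasDerivAt_shiftedLogSum {k : ℕ} (m : Fin k → ℤ) {x : ℝ} (hx : 0 ≤ x) :
    HasDerivAt (shiftedLogSum m) (∑ j, (m j : ℝ) * (x + ((j : ℕ) + 1 : ℝ))⁻¹) x := by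
  unfold shiftedLogSum
  refine HasDerivAt.fun_sum fun j _ => ?_
  have h : x + ((j : ℕ) + 1 : ℝ) ≠ 0 := by positivity
  simpa using (((hasDerivAt_id x).add_const _).log h).const_mul (m j : ℝ)

theorem eval_shiftedLogSumDerivNumerator {k : ℕ} (m : Fin k → ℤ) {x : ℝ} (hx : 0 ≤ x) :
    (shiftedLogSumDerivNumerator m).eval x =
      (∑ j, (m j : ℝ) * (x + ((j : ℕ) + 1 : ℝ))⁻¹) * ∏ i : Fin k, (x + ((i : ℕ) + 1 : ℝ)) := by
  simp only [shiftedLogSumDerivNumerator, Polynomial.eval_finsetSum, Polynomial.eval_mul,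
    Polynomial.eval_prod, Polynomial.eval_add, Polynomial.eval_X, Polynomial.eval_C,
    Finset.sum_mul]
  refine Finset.sum_congr rfl fun j _ => ?_
  have h : x + ((j : ℕ) + 1 : ℝ) ≠ 0 := by positivity
  rw [← Finset.mul_prod_erase Finset.univ _ (Finset.mem_univ j), mul_assoc,
    inv_mul_cancel_left₀ h]

/-- The numerator does not vanish: at the pole `-(j + 1)` only the `j`-th term survives, with a
nonzero multiple of `m j`. -/
theorem shiftedLogSumDerivNumerator_ne_zero {k : ℕ} {m : Fin k → ℤ} (hm : m ≠ 0) :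
    shiftedLogSumDerivNumerator m ≠ 0 := by
  obtain ⟨j, hj⟩ := Function.ne_iff.mp hm
  intro h
  have h0 := congrArg (Polynomial.eval (-((j : ℕ) + 1 : ℝ))) h
  simp only [shiftedLogSumDerivNumerator, Polynomial.eval_finsetSum, Polynomial.eval_mul,
    Polynomial.eval_prod, Polynomial.eval_add, Polynomial.eval_X, Polynomial.eval_C,
    Polynomial.eval_zero] at h0
  rw [Finset.sum_eq_single j] at h0
  · rcases mul_eq_zero.mp h0 with h1 | h1
    · exact hj (by exact_mod_cast h1)
    · obtain ⟨i, hi, h2⟩ := Finset.prod_eq_zero_iff.mp h1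
      have h3 : ((i : ℕ) : ℝ) = (j : ℕ) := by linarith
      exact (Finset.mem_erase.mp hi).1 (Fin.ext (by exact_mod_cast h3))
  · intro i _ hij
    rw [Finset.prod_eq_zero (Finset.mem_erase.mpr ⟨hij.symm, Finset.mem_univ j⟩)
      (neg_add_cancel _), mul_zero]
  · simp

theorem natDegree_shiftedLogSumDerivNumerator_le {k : ℕ} (m : Fin k → ℤ) :
    (shiftedLogSumDerivNumerator m).natDegree ≤ k - 1 := by
  refine Polynomial.natDegree_sum_le_of_forall_le _ _ fun j _ => ?_
  refine (Polynomial.natDegree_C_mul_le _ _).trans ((Polynomial.natDegree_prod_le _ _).trans ?_)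
  simp only [Polynomial.natDegree_X_add_C]
  simp

/-- By Rolle's theorem, `shiftedLogSum m` takes each value at most `k` times on `[0, ∞)`. -/
theorem card_le_of_shiftedLogSum_eq {k : ℕ} {m : Fin k → ℤ} (hm : m ≠ 0) (s : Finset ℝ) (c : ℝ)
    (h0 : ∀ x ∈ s, 0 ≤ x) (hs : ∀ x ∈ s, shiftedLogSum m x = c) : s.card ≤ k := by
  have hQ := shiftedLogSumDerivNumerator_ne_zero hm
  have hk : 0 < k := by
    obtain ⟨j, -⟩ := Function.ne_iff.mp hm
    exact j.pos
  have hle : s.card ≤ (shiftedLogSumDerivNumerator m).roots.toFinset.card + 1 := by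
    refine Finset.card_le_of_interleaved fun x hx y hy hxy _ => ?_
    obtain ⟨z, hz, hz0⟩ := exists_hasDerivAt_eq_zero hxy
      (fun t ht => (hasDerivAt_shiftedLogSum m ((h0 x hx).trans ht.1)).continuousAt
        |>.continuousWithinAt)
      ((hs x hx).trans (hs y hy).symm)
      (fun t ht => hasDerivAt_shiftedLogSum m ((h0 x hx).trans ht.1.le))
    refine ⟨z, ?_, hz.1, hz.2⟩
    rw [Multiset.mem_toFinset, Polynomial.mem_roots hQ, Polynomial.IsRoot,
      eval_shiftedLogSumDerivNumerator m ((h0 x hx).trans hz.1.le), hz0, zero_mul]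
  have := (Multiset.toFinset_card_le _).trans ((Polynomial.card_roots' _).trans
    (natDegree_shiftedLogSumDerivNumerator_le m))
  omega

/-! ### Correlations of the characters of consecutive values -/

theorem continuous_circle_coe : Continuous fun z : Circle => (z : ℂ) := by
  fun_prop

theorem zpow_finsetSum {G ι : Type*} [CommGroup G] (g : G) (s : Finset ι) (a : ι → ℤ) :
    g ^ ∑ i ∈ s, a i = ∏ i ∈ s, g ^ a i := by
  classical
  induction s using Finset.induction_on with
  | empty => simp
  | insert i s hi ih => rw [Finset.sum_insert hi, Finset.prod_insert hi, zpow_add, ih]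

/-- The character `z ↦ ∏ j, z j ^ m j` of the torus. -/
noncomputable def torusCharacter {k : ℕ} (m : Fin k → ℤ) (z : Fin k → Circle) : Circle :=
  ∏ j, z j ^ m j

theorem continuous_torusCharacter {k : ℕ} (m : Fin k → ℤ) : Continuous (torusCharacter m) := by
  unfold torusCharacter
  fun_prop

instance circleUniform.instIsHaarMeasure : circleUniform.IsHaarMeasure :=
  inferInstanceAs (Measure.haarMeasure ⊤).IsHaarMeasure

/-- Rotation by an angle `π / a` changes the sign of `z ^ a`. -/
theorem integral_circleUniform_zpow {a : ℤ} (ha : a ≠ 0) :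
    ∫ z, ((z ^ a : Circle) : ℂ) ∂circleUniform = 0 := by
  refine integral_eq_zero_of_mul_left_eq_neg (g := Circle.exp (Real.pi / a)) fun z => ?_
  have h : (a : ℝ) ≠ 0 := by exact_mod_cast ha
  have : Circle.exp (Real.pi / a) ^ a = Circle.exp Real.pi := by
    rw [← Circle.exp_zsmul, zsmul_eq_mul, mul_div_cancel₀ _ h]
  rw [mul_zpow, this, Circle.coe_mul, Circle.coe_exp, Complex.exp_pi_mul_I, neg_one_mul]

/-- The exponent of `p` in the rational number `∏ j, (n + j + 1) ^ m j`. -/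
noncomputable def shiftedExponent {k : ℕ} (m : Fin k → ℤ) (n : ℕ) (p : Nat.Primes) : ℤ :=
  ∑ j, m j * ((n + (j + 1 : ℕ)).factorization p : ℤ)

/-- The primes up to `M`. -/
noncomputable def primesUpTo (M : ℕ) : Finset Nat.Primes :=
  (Finset.range (M + 1)).subtype Nat.Prime

theorem mem_primesUpTo {M : ℕ} {p : Nat.Primes} : p ∈ primesUpTo M ↔ (p : ℕ) ≤ M :=
  Finset.mem_subtype.trans Finset.mem_range_succ_iff

namespace IsUniformRandomMultiplicative

variable {Ω : Type*} [MeasurableSpace Ω] {P : Measure Ω}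
  {X : ℕ → Ω → Circle}

theorem map_one (hX : IsUniformRandomMultiplicative P X) (ω : Ω) : X 1 ω = 1 := by
  simpa using hX.map_mul 1 1 le_rfl le_rfl ω

theorem eq_prod_pow_factorization (hX : IsUniformRandomMultiplicative P X)
    (S : Finset Nat.Primes) (ω : Ω) (n : ℕ) (hn : n ≠ 0)
    (hS : ∀ p : Nat.Primes, (p : ℕ) ∣ n → p ∈ S) :
    X n ω = ∏ p ∈ S, X p ω ^ n.factorization p := by
  induction n using Nat.recOnMul with
  | zero => exact absurd rfl hn
  | one => simp [hX.map_one]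
  | prime p hp =>
    have hpS : (⟨p, hp⟩ : Nat.Primes) ∈ S := hS ⟨p, hp⟩ dvd_rfl
    refine ((Finset.prod_eq_single (⟨p, hp⟩ : Nat.Primes) ?_ fun h => absurd hpS h).trans ?_).symm
    · intro q _ hq
      have : p ≠ (q : ℕ) := fun h => hq (Subtype.ext h.symm)
      simp [hp.factorization, this]
    · simp [hp.factorization]
  | mul a b iha ihb =>
    obtain ⟨ha, hb⟩ := mul_ne_zero_iff.mp hn
    rw [hX.map_mul a b (Nat.one_le_iff_ne_zero.mpr ha) (Nat.one_le_iff_ne_zero.mpr hb),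
      iha ha fun p hp => hS p (hp.mul_right b), ihb hb fun p hp => hS p (hp.mul_left a),
      ← Finset.prod_mul_distrib, Nat.factorization_mul ha hb]
    simp [pow_add]

theorem measurable_apply (hX : IsUniformRandomMultiplicative P X) {n : ℕ} (hn : n ≠ 0) :
    Measurable (X n) := by
  have : X n = fun ω => ∏ p ∈ primesUpTo n, X p ω ^ n.factorization p := by
    ext1 ω
    exact hX.eq_prod_pow_factorization _ ω n hn fun p hp =>
      mem_primesUpTo.mpr (Nat.le_of_dvd (Nat.pos_of_ne_zero hn) hp)
  rw [this]
  exact Finset.measurable_fun_prod _ fun p _ => (hX.measurable_prime p).pow_const _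

theorem measurable_torusCharacter (hX : IsUniformRandomMultiplicative P X) {k : ℕ}
    (m : Fin k → ℤ) (n : ℕ) :
    Measurable fun ω => torusCharacter m fun j => X (n + (j + 1)) ω :=
  (continuous_torusCharacter m).measurable.comp
    (measurable_pi_lambda _ fun j => hX.measurable_apply (by omega))

/-- A nontrivial monomial in the values at the primes has mean zero. -/
theorem integral_prod_zpow_eq_zero (hX : IsUniformRandomMultiplicative P X)
    (S : Finset Nat.Primes) (a : Nat.Primes → ℤ) {p : Nat.Primes} (hp : p ∈ S) (ha : a p ≠ 0) :
    ∫ ω, ((∏ q ∈ S, X q ω ^ a q : Circle) : ℂ) ∂P = 0 := by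
  have hind := hX.iIndepFun_prime.precomp (g := fun q : S => (q : Nat.Primes))
    Subtype.val_injective
  have hcont : ∀ b : ℤ, Continuous fun z : Circle => ((z ^ b : Circle) : ℂ) := fun b =>
    continuous_circle_coe.comp (continuous_zpow b)
  have h := hind.integral_fun_prod_comp (f := fun (q : S) z => ((z ^ a q : Circle) : ℂ))
    (fun q => (hX.measurable_prime q).aemeasurable)
    (fun q => (hcont _).aestronglyMeasurable)
  have hcoe : ∀ ω, ((∏ q ∈ S, X q ω ^ a q : Circle) : ℂ) =
      ∏ q : S, ((X (q : Nat.Primes) ω ^ a q : Circle) : ℂ) := fun ω => by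
    rw [← Finset.prod_coe_sort]
    exact map_prod Circle.coeHom _ _
  simp_rw [hcoe]
  rw [h]
  refine Finset.prod_eq_zero (Finset.mem_univ (⟨p, hp⟩ : S)) ?_
  rw [← integral_map (f := fun z : Circle => ((z ^ a p : Circle) : ℂ))
    (hX.measurable_prime p).aemeasurable
    (hcont _).aestronglyMeasurable,
    hX.map_prime p, integral_circleUniform_zpow ha]

theorem torusCharacter_eq_prod (hX : IsUniformRandomMultiplicative P X) {k : ℕ}
    (m : Fin k → ℤ) (n : ℕ) (ω : Ω) (S : Finset Nat.Primes)
    (hS : ∀ p : Nat.Primes, (p : ℕ) ≤ n + k → p ∈ S) :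
    torusCharacter m (fun j => X (n + (j + 1)) ω) = ∏ p ∈ S, X p ω ^ shiftedExponent m n p := by
  have h : ∀ j : Fin k, X (n + (j + 1)) ω =
      ∏ p ∈ S, X p ω ^ (n + (j + 1 : ℕ)).factorization p := fun j =>
    hX.eq_prod_pow_factorization S ω _ (by omega) fun p hp => hS p (by
      have := Nat.le_of_dvd (by omega) hp
      omega)
  simp only [torusCharacter, h, shiftedExponent, ← Finset.prod_zpow]
  rw [Finset.prod_comm]
  refine Finset.prod_congr rfl fun p _ => ?_
  rw [zpow_finsetSum]
  refine Finset.prod_congr rfl fun j _ => ?_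
  rw [mul_comm, zpow_mul, zpow_natCast]

end IsUniformRandomMultiplicative

/-- `shiftedLogSum m n` depends only on the prime exponents of `∏ j, (n + j + 1) ^ m j`. -/
theorem shiftedLogSum_natCast_eq {k : ℕ} (m : Fin k → ℤ) (n : ℕ) (S : Finset Nat.Primes)
    (hS : ∀ p : Nat.Primes, (p : ℕ) ≤ n + k → p ∈ S) :
    shiftedLogSum m n = ∑ p ∈ S, (shiftedExponent m n p : ℝ) * Real.log (p : ℕ) := by
  have h : ∀ j : Fin k, Real.log ((n : ℝ) + ((j : ℕ) + 1 : ℝ)) =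
      ∑ p ∈ S, ((n + (j + 1 : ℕ)).factorization p : ℝ) * Real.log (p : ℕ) := fun j => by
    have h1 := Real.log_nat_eq_sum_factorization (n + (j + 1))
    push_cast at h1
    rw [h1, Finsupp.sum]
    have hsub : (n + (j + 1 : ℕ)).factorization.support ⊆
        S.map ⟨((↑) : Nat.Primes → ℕ), Nat.Primes.coe_nat_injective⟩ := fun p hp => by
      rw [Nat.support_factorization, Nat.mem_primeFactors] at hp
      have := Nat.le_of_dvd (by omega) hp.2.1
      exact Finset.mem_map.mpr ⟨⟨p, hp.1⟩, hS ⟨p, hp.1⟩ (by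
        change p ≤ n + k
        omega), rfl⟩
    rw [Finset.sum_subset hsub fun p _ hp => by
      rw [Finsupp.notMem_support_iff.mp hp, Nat.cast_zero, zero_mul]]
    exact Finset.sum_map _ _ _
  simp only [shiftedLogSum, h, shiftedExponent, Finset.mul_sum]
  rw [Finset.sum_comm]
  refine Finset.sum_congr rfl fun p _ => ?_
  push_cast
  rw [Finset.sum_mul]
  exact Finset.sum_congr rfl fun j _ => by ring

namespace IsUniformRandomMultiplicative

variable {Ω : Type*} [MeasurableSpace Ω] {P : Measure Ω}
  {X : ℕ → Ω → Circle}

/-- Unequal values of `shiftedLogSum m` at `n` and `n'` mean that the rational numbers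
`∏ j, (n + j + 1) ^ m j` and `∏ j, (n' + j + 1) ^ m j` differ in the exponent of some prime. -/
theorem integral_torusCharacter_mul_inv_eq_zero (hX : IsUniformRandomMultiplicative P X) {k : ℕ}
    (m : Fin k → ℤ) {n n' : ℕ} (h : shiftedLogSum m n ≠ shiftedLogSum m n') :
    ∫ ω, ((torusCharacter m (fun j => X (n + (j + 1)) ω) *
      (torusCharacter m (fun j => X (n' + (j + 1)) ω))⁻¹ : Circle) : ℂ) ∂P = 0 := by
  set S : Finset Nat.Primes := primesUpTo (n + n' + k)
  have hS1 : ∀ p : Nat.Primes, (p : ℕ) ≤ n + k → p ∈ S := fun p hp =>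
    mem_primesUpTo.mpr (by omega)
  have hS2 : ∀ p : Nat.Primes, (p : ℕ) ≤ n' + k → p ∈ S := fun p hp =>
    mem_primesUpTo.mpr (by omega)
  obtain ⟨p, hp, hne⟩ : ∃ p ∈ S, shiftedExponent m n p - shiftedExponent m n' p ≠ 0 := by
    by_contra! hcon
    refine h ?_
    rw [shiftedLogSum_natCast_eq m n S hS1, shiftedLogSum_natCast_eq m n' S hS2]
    exact Finset.sum_congr rfl fun p hp => by rw [sub_eq_zero.mp (hcon p hp)]
  -- The integrand is the monomial in the prime values with the differences as exponents.
  rw [← hX.integral_prod_zpow_eq_zero S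
    (fun p => shiftedExponent m n p - shiftedExponent m n' p) hp hne]
  congr 1 with ω
  rw [hX.torusCharacter_eq_prod m n ω S hS1, hX.torusCharacter_eq_prod m n' ω S hS2,
    ← Finset.prod_inv_distrib, ← Finset.prod_mul_distrib]
  simp only [zpow_sub]

/-- The mean square of a sum of `#I` characters of consecutive values is at most `k #I`, uniformly
in the nonzero frequency `m`. -/
theorem integral_norm_sum_sq_le [IsProbabilityMeasure P]
    (hX : IsUniformRandomMultiplicative P X) {k : ℕ} {m : Fin k → ℤ} (hm : m ≠ 0) (I : Finset ℕ) :
    ∫ ω, ‖∑ n ∈ I, (torusCharacter m (fun j => X (n + (j + 1)) ω) : ℂ)‖ ^ 2 ∂P ≤ k * I.card := by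
  classical
  set Y : ℕ → Ω → Circle := fun n ω => torusCharacter m fun j => X (n + (j + 1)) ω with hY
  set e : ℕ → ℕ → ℂ := fun n n' => ∫ ω, ((Y n ω * (Y n' ω)⁻¹ : Circle) : ℂ) ∂P with he
  have hYm : ∀ n, Measurable (Y n) := fun n => hX.measurable_torusCharacter m n
  have hint : ∀ n n', Integrable (fun ω => ((Y n ω * (Y n' ω)⁻¹ : Circle) : ℂ)) P := fun n n' => by
    refine Integrable.of_bound (C := 1) ?_ (Eventually.of_forall fun ω => (Circle.norm_coe _).le)
    exact (continuous_circle_coe.measurable.comp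
      ((hYm n).mul (hYm n').inv)).aestronglyMeasurable
  have hexp : ((∫ ω, ‖∑ n ∈ I, (Y n ω : ℂ)‖ ^ 2 ∂P : ℝ) : ℂ) =
      ∑ n ∈ I, ∑ n' ∈ I, e n n' := by
    rw [← integral_complex_ofReal]
    simp only [he]
    simp_rw [← integral_finsetSum I fun n' _ => hint _ n']
    rw [← integral_finsetSum I fun n _ => integrable_finsetSum I fun n' _ => hint n n']
    congr 1 with ω
    rw [Complex.ofReal_pow, ← Complex.mul_conj', map_sum, Finset.sum_mul_sum]
    simp only [Circle.coe_mul, Circle.coe_inv_eq_conj]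
  -- Only pairs with equal `shiftedLogSum m` are correlated, and each `n` has at most `k` of them.
  have hle : ∀ n n', ‖e n n'‖ ≤ if shiftedLogSum m n' = shiftedLogSum m n then 1 else 0 := by
    intro n n'
    split_ifs with h
    · refine (norm_integral_le_of_norm_le_const (C := 1)
        (Eventually.of_forall fun ω => (Circle.norm_coe _).le)).trans ?_
      simp
    · rw [he]
      exact (norm_eq_zero.mpr
        (hX.integral_torusCharacter_mul_inv_eq_zero m fun h' => h h'.symm)).le
  calc ∫ ω, ‖∑ n ∈ I, (Y n ω : ℂ)‖ ^ 2 ∂P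
      ≤ ‖((∫ ω, ‖∑ n ∈ I, (Y n ω : ℂ)‖ ^ 2 ∂P : ℝ) : ℂ)‖ := by
        rw [Complex.norm_real]; exact le_abs_self _
    _ ≤ ∑ n ∈ I, ∑ n' ∈ I, ‖e n n'‖ := by
        rw [hexp]
        exact (norm_sum_le _ _).trans (Finset.sum_le_sum fun n _ => norm_sum_le _ _)
    _ ≤ ∑ n ∈ I, (k : ℝ) := by
        refine Finset.sum_le_sum fun n _ => (Finset.sum_le_sum fun n' _ => hle n n').trans ?_
        rw [Finset.sum_boole]
        set J := I.filter fun n' : ℕ => shiftedLogSum m n' = shiftedLogSum m n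
        have := card_le_of_shiftedLogSum_eq hm (J.map Nat.castEmbedding) (shiftedLogSum m n)
          (by simp)
          (by
            intro x hx
            obtain ⟨n', hn', rfl⟩ := Finset.mem_map.mp hx
            exact (Finset.mem_filter.mp hn').2)
        rw [Finset.card_map] at this
        exact_mod_cast this
    _ = k * I.card := by rw [Finset.sum_const, nsmul_eq_mul, mul_comm]

end IsUniformRandomMultiplicative

/-! ### A dyadic maximal inequality -/

/-- The sum of the squared norms of all dyadic block sums of `c` inside `[0, 2 ^ R)`, with the
factor `R` that makes it a bound for every squared partial sum. -/
noncomputable def dyadicSquareSum {E : Type*} [NormedAddCommGroup E] (c : ℕ → E) (R : ℕ) : ℝ :=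
  R * ∑ r ∈ Finset.range R, ∑ i ∈ Finset.range (2 ^ (R - r)),
    ‖∑ n ∈ Finset.Ico (i * 2 ^ r) ((i + 1) * 2 ^ r), c n‖ ^ 2

/-- The Rademacher–Menshov inequality: the binary expansion of `N` writes `[0, N)` as a disjoint
union of at most one dyadic block of each length `2 ^ r`, `r < R`. -/
theorem norm_sum_range_sq_le_dyadicSquareSum {E : Type*} [NormedAddCommGroup E] (c : ℕ → E)
    {R N : ℕ} (hN : N < 2 ^ R) :
    ‖∑ n ∈ Finset.range N, c n‖ ^ 2 ≤ dyadicSquareSum c R := by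
  -- Rounding `N` down to multiples of `2 ^ r` telescopes from `N` at `r = 0` to `0` at `r = R`.
  set T : ℕ → E := fun r => ∑ n ∈ Finset.range (N / 2 ^ r * 2 ^ r), c n with hT
  have hT0 : T 0 = ∑ n ∈ Finset.range N, c n := by simp [hT]
  have hTR : T R = 0 := by simp [hT, Nat.div_eq_of_lt hN]
  have htel : ∑ n ∈ Finset.range N, c n = ∑ r ∈ Finset.range R, (T r - T (r + 1)) := by
    rw [Finset.sum_range_sub', hT0, hTR, sub_zero]
  have hblock : ∀ r ∈ Finset.range R, ‖T r - T (r + 1)‖ ^ 2 ≤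
      ∑ i ∈ Finset.range (2 ^ (R - r)),
        ‖∑ n ∈ Finset.Ico (i * 2 ^ r) ((i + 1) * 2 ^ r), c n‖ ^ 2 := by
    intro r hr
    have hrR : r < R := Finset.mem_range.mp hr
    set q := N / 2 ^ (r + 1) with hq
    have hq' : N / 2 ^ r / 2 = q := by rw [Nat.div_div_eq_div_mul, ← pow_succ]
    have hlt : N / 2 ^ r < 2 ^ (R - r) := by
      rw [Nat.div_lt_iff_lt_mul (by positivity), ← pow_add, Nat.sub_add_cancel hrR.le]
      exact hN
    have hTs : T (r + 1) = ∑ n ∈ Finset.range (2 * q * 2 ^ r), c n := by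
      simp only [hT, ← hq]
      congr 2
      ring
    have hnn : ∀ i ∈ Finset.range (2 ^ (R - r)),
        0 ≤ ‖∑ n ∈ Finset.Ico (i * 2 ^ r) ((i + 1) * 2 ^ r), c n‖ ^ 2 := fun _ _ => by positivity
    rcases Nat.mod_two_eq_zero_or_one (N / 2 ^ r) with h | h
    · have h2 : N / 2 ^ r = 2 * q := by omega
      have : T r = T (r + 1) := by rw [hTs, ← h2]
      rw [this, sub_self, norm_zero, zero_pow two_ne_zero]
      exact Finset.sum_nonneg hnn
    · have h2 : N / 2 ^ r = 2 * q + 1 := by omega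
      have hdiff : T r - T (r + 1) =
          ∑ n ∈ Finset.Ico (2 * q * 2 ^ r) ((2 * q + 1) * 2 ^ r), c n := by
        rw [hTs, Finset.sum_Ico_eq_sub _ (Nat.mul_le_mul_right _ (Nat.le_add_right (2 * q) 1)), ← h2]
      rw [hdiff]
      exact Finset.single_le_sum hnn (Finset.mem_range.mpr (by omega))
  rw [htel, dyadicSquareSum]
  calc ‖∑ r ∈ Finset.range R, (T r - T (r + 1))‖ ^ 2
      ≤ (∑ r ∈ Finset.range R, ‖T r - T (r + 1)‖) ^ 2 := by gcongr; exact norm_sum_le _ _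
    _ ≤ R * ∑ r ∈ Finset.range R, ‖T r - T (r + 1)‖ ^ 2 := by
        simpa using sq_sum_le_card_mul_sum_sq (s := Finset.range R)
          (f := fun r => ‖T r - T (r + 1)‖)
    _ ≤ _ := by gcongr with r hr; exact hblock r hr

/-! ### Almost sure square-root cancellation, uniform in the frequency -/

theorem norm_intCast_comp {k : ℕ} (m : Fin k → ℤ) : ‖fun j => (m j : ℝ)‖ = ‖m‖ := by
  simp only [Pi.norm_def, nnnorm, Int.norm_eq_abs, Real.norm_eq_abs]

theorem summable_norm_rpow_of_lt {k : ℕ} {s : ℝ} (hs : s < -k) :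
    Summable fun m : Fin k → ℤ => ‖m‖ ^ s := by
  set L := Submodule.span ℤ (Set.range (Pi.basisFun ℝ (Fin k)))
  have hrank : Module.finrank ℤ L = k := by
    rw [Module.finrank_eq_card_basis ((Pi.basisFun ℝ (Fin k)).restrictScalars ℤ),
      Fintype.card_fin]
  have hmem : ∀ m : Fin k → ℤ, (fun j => (m j : ℝ)) ∈ L := fun m => by
    rw [(Pi.basisFun ℝ (Fin k)).mem_span_iff_repr_mem ℤ]
    intro j
    exact ⟨m j, by simp⟩
  have hinj : Function.Injective fun m : Fin k → ℤ => (⟨_, hmem m⟩ : L) := fun m m' h => by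
    ext j
    have : (m j : ℝ) = m' j := congrFun (congrArg Subtype.val h) j
    exact_mod_cast this
  refine ((ZLattice.summable_norm_rpow L s (by rwa [hrank])).comp_injective hinj).congr fun m => ?_
  rw [← norm_intCast_comp]
  rfl

/-- A nonnegative family with summable integrals is almost surely bounded. -/
theorem ae_exists_forall_le_of_summable_integral {Ω ι : Type*} [Countable ι] [MeasurableSpace Ω]
    {P : Measure Ω} {g : ι → Ω → ℝ} {b : ι → ℝ} (hg : ∀ i, Integrable (g i) P)
    (h0 : ∀ i ω, 0 ≤ g i ω) (hb : Summable b) (hgb : ∀ i, ∫ ω, g i ω ∂P ≤ b i) :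
    ∀ᵐ ω ∂P, ∃ C : ℝ, ∀ i, g i ω ≤ C := by
  have hmeas : ∀ i, AEMeasurable (fun ω => ENNReal.ofReal (g i ω)) P := fun i =>
    (hg i).aestronglyMeasurable.aemeasurable.ennreal_ofReal
  have hfin : ∫⁻ ω, ∑' i, ENNReal.ofReal (g i ω) ∂P ≠ ⊤ := by
    rw [lintegral_tsum hmeas]
    refine ne_top_of_le_ne_top hb.tsum_ofReal_ne_top (ENNReal.tsum_le_tsum fun i => ?_)
    rw [← ofReal_integral_eq_lintegral_ofReal (hg i) (Eventually.of_forall (h0 i))]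
    exact ENNReal.ofReal_le_ofReal (hgb i)
  filter_upwards [ae_lt_top' (AEMeasurable.tsum hmeas) hfin] with ω hω
  refine ⟨(∑' i, ENNReal.ofReal (g i ω)).toReal, fun i => ?_⟩
  rw [← ENNReal.ofReal_le_iff_le_toReal hω.ne]
  exact ENNReal.le_tsum i

namespace IsUniformRandomMultiplicative

variable {Ω : Type*} [MeasurableSpace Ω] {P : Measure Ω} {X : ℕ → Ω → Circle}

theorem integrable_norm_sum_sq [IsProbabilityMeasure P] (hX : IsUniformRandomMultiplicative P X)
    {k : ℕ} (m : Fin k → ℤ) (I : Finset ℕ) :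
    Integrable (fun ω =>
      ‖∑ n ∈ I, (torusCharacter m (fun j => X (n + 1 + (j + 1)) ω) : ℂ)‖ ^ 2) P := by
  have hmeas : Measurable fun ω =>
      ∑ n ∈ I, (torusCharacter m (fun j => X (n + 1 + (j + 1)) ω) : ℂ) :=
    Finset.measurable_fun_sum _ fun n _ =>
      continuous_circle_coe.measurable.comp (hX.measurable_torusCharacter m (n + 1))
  refine Integrable.of_bound (C := (I.card : ℝ) ^ 2)
    (hmeas.norm.pow_const 2).aestronglyMeasurable (Eventually.of_forall fun ω => ?_)
  rw [Real.norm_of_nonneg (by positivity)]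
  gcongr
  refine (norm_sum_le_of_le I fun n _ => (Circle.norm_coe _).le).trans ?_
  simp

/-- Each of the `R` scales contributes at most `2 ^ (R - r) * (k * 2 ^ r) = k * 2 ^ R` to the
mean. -/
theorem integral_dyadicSquareSum_le [IsProbabilityMeasure P]
    (hX : IsUniformRandomMultiplicative P X) {k : ℕ} {m : Fin k → ℤ} (hm : m ≠ 0) (R : ℕ) :
    ∫ ω, dyadicSquareSum (fun n => (torusCharacter m (fun j => X (n + 1 + (j + 1)) ω) : ℂ)) R ∂P
      ≤ R ^ 2 * k * 2 ^ R := by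
  have hI : ∀ I : Finset ℕ, ∫ ω,
      ‖∑ n ∈ I, (torusCharacter m (fun j => X (n + 1 + (j + 1)) ω) : ℂ)‖ ^ 2 ∂P ≤ k * I.card := by
    intro I
    have := hX.integral_norm_sum_sq_le hm (I.map (addRightEmbedding 1))
    simpa only [Finset.sum_map, Finset.card_map, addRightEmbedding_apply] using this
  simp only [dyadicSquareSum]
  rw [integral_const_mul, integral_finsetSum _ fun r _ => integrable_finsetSum _ fun i _ =>
    hX.integrable_norm_sum_sq m _]
  simp_rw [integral_finsetSum _ fun i _ => hX.integrable_norm_sum_sq m _]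
  calc _ ≤ (R : ℝ) * ∑ r ∈ Finset.range R, ∑ i ∈ Finset.range (2 ^ (R - r)), (k * 2 ^ r : ℝ) := by
        gcongr with r hr i hi
        refine (hI _).trans_eq ?_
        rw [Nat.card_Ico, add_one_mul, Nat.add_sub_cancel_left]
        push_cast
        rfl
    _ = (R : ℝ) * ∑ r ∈ Finset.range R, (k * 2 ^ R : ℝ) := by
        congr 1
        refine Finset.sum_congr rfl fun r hr => ?_
        rw [Finset.sum_const, Finset.card_range, nsmul_eq_mul]
        push_cast
        rw [← Nat.sub_add_cancel (Finset.mem_range.mp hr).le, pow_add, Nat.add_sub_cancel]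
        ring
    _ = _ := by
        rw [Finset.sum_const, Finset.card_range, nsmul_eq_mul]
        ring

theorem integrable_dyadicSquareSum [IsProbabilityMeasure P]
    (hX : IsUniformRandomMultiplicative P X) {k : ℕ} (m : Fin k → ℤ) (R : ℕ) :
    Integrable (fun ω => dyadicSquareSum
      (fun n => (torusCharacter m (fun j => X (n + 1 + (j + 1)) ω) : ℂ)) R) P :=
  (integrable_finsetSum _ fun _ _ => integrable_finsetSum _ fun _ _ =>
    hX.integrable_norm_sum_sq m _).const_mul _

end IsUniformRandomMultiplicative

/-- Square-root cancellation with a loss of `‖m‖ ^ u` in the frequency and of `N ^ ε` in the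
length, for the characters of the `k`-tuples of consecutive values of the sequence `x`. -/
def HasCharacterSumBound (x : ℕ → Circle) (k : ℕ) (u ε : ℝ) : Prop :=
  ∃ C : ℝ, ∀ m : Fin k → ℤ, m ≠ 0 → ∀ N : ℕ, 1 ≤ N →
    ‖∑ n ∈ Finset.Icc 1 N, (torusCharacter m (fun j => x (n + (j + 1))) : ℂ)‖ ≤
      C * ‖m‖ ^ u * (N : ℝ) ^ (1 / 2 + ε)

theorem sum_Icc_one_eq_sum_range {E : Type*} [AddCommMonoid E] (c : ℕ → E) (N : ℕ) :
    ∑ n ∈ Finset.Icc 1 N, c n = ∑ n ∈ Finset.range N, c (n + 1) := by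
  rw [← Finset.Ico_add_one_right_eq_Icc, Finset.sum_Ico_eq_sum_range, Nat.add_sub_cancel]
  simp only [add_comm]

theorem summable_sq_mul_rpow_neg {ε : ℝ} (hε : 0 < ε) (k : ℕ) :
    Summable fun R : ℕ => ((2 : ℝ) ^ R) ^ (-(1 + 2 * ε)) * ((R : ℝ) ^ 2 * k * 2 ^ R) := by
  have h1 : ‖(2 : ℝ) ^ (-(2 * ε))‖ < 1 := by
    rw [Real.norm_of_nonneg (by positivity)]
    exact Real.rpow_lt_one_of_one_lt_of_neg one_lt_two (by linarith)
  refine ((summable_pow_mul_geometric_of_norm_lt_one 2 h1).mul_left (k : ℝ)).congr fun R => ?_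
  have h2 : ((2 : ℝ) ^ R) ^ (-(1 + 2 * ε)) * 2 ^ R = ((2 : ℝ) ^ (-(2 * ε))) ^ R := by
    rw [← Real.rpow_natCast, ← Real.rpow_natCast, ← Real.rpow_mul two_pos.le,
      ← Real.rpow_add two_pos, ← Real.rpow_mul two_pos.le]
    congr 1
    ring
  rw [← h2]
  ring

/-- A bound on the weighted dyadic square sums controls every character sum: a sum of length `N` is
controlled at the scale `2 ^ R` with `N < 2 ^ R ≤ 2 * N`. -/
theorem hasCharacterSumBound_of_dyadicSquareSum_le {x : ℕ → Circle} {k : ℕ} {u ε C : ℝ}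
    (hε : 0 < ε) (h : ∀ m : Fin k → ℤ, m ≠ 0 → ∀ R : ℕ,
      ‖m‖ ^ (-(2 * u)) * (((2 : ℝ) ^ R) ^ (-(1 + 2 * ε)) *
        dyadicSquareSum (fun n => (torusCharacter m (fun j => x (n + 1 + (j + 1))) : ℂ)) R) ≤ C) :
    HasCharacterSumBound x k u ε := by
  refine ⟨√(C * 2 ^ (1 + 2 * ε)), fun m hm N hN => ?_⟩
  have hm0 : 0 < ‖m‖ := norm_pos_iff.mpr hm
  have hN0 : (0 : ℝ) < N := by exact_mod_cast hN
  set R := Nat.log 2 N + 1 with hR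
  have hlt : N < 2 ^ R := Nat.lt_pow_succ_log_self one_lt_two N
  have hle : (2 : ℝ) ^ R ≤ 2 * N := by
    have := Nat.pow_log_le_self 2 (Nat.one_le_iff_ne_zero.mp hN)
    rw [hR, pow_succ, mul_comm]
    gcongr
    exact_mod_cast this
  set S := ∑ n ∈ Finset.range N, (torusCharacter m (fun j => x (n + 1 + (j + 1))) : ℂ) with hS
  have hS2 := norm_sum_range_sq_le_dyadicSquareSum
    (fun n => (torusCharacter m (fun j => x (n + 1 + (j + 1))) : ℂ)) hlt
  rw [← hS] at hS2
  have hC : ‖m‖ ^ (-(2 * u)) * (((2 : ℝ) ^ R) ^ (-(1 + 2 * ε)) * ‖S‖ ^ 2) ≤ C :=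
    le_trans (by gcongr) (h m hm R)
  have hC0 : 0 ≤ C := le_trans (by positivity) hC
  rw [Real.rpow_neg hm0.le, Real.rpow_neg (by positivity), inv_mul_le_iff₀ (by positivity),
    inv_mul_le_iff₀ (by positivity)] at hC
  rw [sum_Icc_one_eq_sum_range, ← hS]
  refine abs_le_of_sq_le_sq' ?_ (by positivity) |>.2
  calc ‖S‖ ^ 2 ≤ ((2 : ℝ) ^ R) ^ (1 + 2 * ε) * (‖m‖ ^ (2 * u) * C) := hC
    _ ≤ (2 * N : ℝ) ^ (1 + 2 * ε) * (‖m‖ ^ (2 * u) * C) := by gcongr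
    _ = _ := by
        rw [mul_pow, mul_pow, Real.sq_sqrt (by positivity), Real.mul_rpow two_pos.le hN0.le,
          ← Real.rpow_mul_natCast hm0.le, ← Real.rpow_mul_natCast hN0.le]
        push_cast
        rw [mul_comm u 2, show (1 / 2 + ε) * 2 = 1 + 2 * ε by ring]
        ring

/-- The mean dyadic square sums, weighted by `‖m‖ ^ (-2u) * 2 ^ (-R (1 + 2ε))`, are
summable over all `m` and `R`: this is where `2 u > k` is needed. -/
theorem IsUniformRandomMultiplicative.ae_hasCharacterSumBound {Ω : Type*} [MeasurableSpace Ω]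
    {P : Measure Ω} [IsProbabilityMeasure P] {X : ℕ → Ω → Circle}
    (hX : IsUniformRandomMultiplicative P X) (k : ℕ) {u ε : ℝ} (hu : (k : ℝ) / 2 < u)
    (hε : 0 < ε) : ∀ᵐ ω ∂P, HasCharacterSumBound (fun n => X n ω) k u ε := by
  have hsum : Summable fun i : {m : Fin k → ℤ // m ≠ 0} × ℕ =>
      ‖i.1.1‖ ^ (-(2 * u)) *
        (((2 : ℝ) ^ i.2) ^ (-(1 + 2 * ε)) * ((i.2 : ℝ) ^ 2 * k * 2 ^ i.2)) :=
    Summable.mul_of_nonneg (f := fun m : {m : Fin k → ℤ // m ≠ 0} => ‖m.1‖ ^ (-(2 * u)))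
      ((summable_norm_rpow_of_lt (by linarith)).comp_injective Subtype.val_injective)
      (summable_sq_mul_rpow_neg hε k) (fun m => Real.rpow_nonneg (norm_nonneg m.1) _)
      (fun R => mul_nonneg (Real.rpow_nonneg (by positivity) _) (by positivity))
  have hbound := ae_exists_forall_le_of_summable_integral (P := P)
    (g := fun (i : {m : Fin k → ℤ // m ≠ 0} × ℕ) ω => ‖i.1.1‖ ^ (-(2 * u)) *
      (((2 : ℝ) ^ i.2) ^ (-(1 + 2 * ε)) * dyadicSquareSum
        (fun n => (torusCharacter i.1.1 (fun j => X (n + 1 + (j + 1)) ω) : ℂ)) i.2))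
    (fun i => ((hX.integrable_dyadicSquareSum i.1.1 i.2).const_mul _).const_mul _)
    (fun i ω => by
      unfold dyadicSquareSum
      positivity) hsum
    (fun i => by
      rw [integral_const_mul, integral_const_mul]
      gcongr
      exact hX.integral_dyadicSquareSum_le i.1.2 i.2)
  filter_upwards [hbound] with ω ⟨C, hC⟩
  exact hasCharacterSumBound_of_dyadicSquareSum_le hε fun m hm R => hC (⟨m, hm⟩, R)

/-! ### Fourier analysis on the torus -/

/-- The circle `ℝ / ℤ` with its normalized Haar measure is identified with the unit circle. -/
theorem measurePreserving_toCircle :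
    MeasurePreserving (AddCircle.toCircle : UnitAddCircle → Circle) AddCircle.haarAddCircle
      circleUniform := by
  have hc : Continuous (AddCircle.toCircle : UnitAddCircle → Circle) := AddCircle.continuous_toCircle
  refine ⟨hc.measurable, ?_⟩
  set μ := (AddCircle.haarAddCircle (T := (1 : ℝ))).map (AddCircle.toCircle : UnitAddCircle → Circle)
    with hμ
  have hprob : IsProbabilityMeasure μ := Measure.isProbabilityMeasure_map hc.aemeasurable
  have hinv : μ.IsMulLeftInvariant := by
    refine ⟨fun g => ?_⟩
    obtain ⟨a, rfl⟩ := (AddCircle.homeomorphCircle (one_ne_zero (α := ℝ))).surjective g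
    rw [AddCircle.homeomorphCircle_apply]
    have hcomp : (fun z => AddCircle.toCircle a * z) ∘ (AddCircle.toCircle : UnitAddCircle → Circle)
        = AddCircle.toCircle ∘ fun t => a + t := by
      ext1 t
      simp [AddCircle.toCircle_add]
    rw [hμ, Measure.map_map (measurable_const_mul _) hc.measurable, hcomp,
      ← Measure.map_map hc.measurable (measurable_const_add a), map_add_left_eq_self]
  have h := Measure.haarMeasure_unique μ ⊤
  rwa [TopologicalSpace.PositiveCompacts.coe_top, measure_univ, one_smul] at h

/-- The coordinatewise identification of `(ℝ / ℤ) ^ k` with `𝕌 ^ k`. -/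
noncomputable def torusHomeomorph (k : ℕ) : UnitAddTorus (Fin k) ≃ₜ (Fin k → Circle) :=
  Homeomorph.piCongrRight fun _ => AddCircle.homeomorphCircle one_ne_zero

theorem torusHomeomorph_apply {k : ℕ} (t : UnitAddTorus (Fin k)) (j : Fin k) :
    torusHomeomorph k t j = AddCircle.toCircle (t j) :=
  AddCircle.homeomorphCircle_apply one_ne_zero (t j)

theorem measurePreserving_torusHomeomorph (k : ℕ) :
    MeasurePreserving (torusHomeomorph k) (Measure.pi fun _ => AddCircle.haarAddCircle)
      (torusUniform k) := by
  have h : ⇑(torusHomeomorph k) = fun t j => AddCircle.toCircle (t j) := by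
    ext1 t
    ext1 j
    exact torusHomeomorph_apply t j
  rw [h]
  exact measurePreserving_pi _ _ fun _ => measurePreserving_toCircle

theorem coe_torusCharacter {k : ℕ} (m : Fin k → ℤ) (z : Fin k → Circle) :
    (torusCharacter m z : ℂ) = ∏ j, ((z j ^ m j : Circle) : ℂ) :=
  map_prod Circle.coeHom (fun j => z j ^ m j) Finset.univ

theorem mFourier_eq_torusCharacter {k : ℕ} (m : Fin k → ℤ) (t : UnitAddTorus (Fin k)) :
    UnitAddTorus.mFourier m t = torusCharacter m (torusHomeomorph k t) := by
  rw [coe_torusCharacter]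
  change ∏ j, fourier (m j) (t j) = _
  refine Finset.prod_congr rfl fun j _ => ?_
  rw [torusHomeomorph_apply, fourier_apply, AddCircle.toCircle_zsmul]

theorem torusFourierCoeff_eq_mFourierCoeff {k : ℕ} (f : (Fin k → Circle) → ℂ) (m : Fin k → ℤ) :
    torusFourierCoeff f m = UnitAddTorus.mFourierCoeff (f ∘ torusHomeomorph k) m := by
  have h := (measurePreserving_torusHomeomorph k).integral_comp
    (torusHomeomorph k).measurableEmbedding (fun z => f z * (torusCharacter (-m) z : ℂ))
  refine Eq.trans h.symm ?_
  refine integral_congr_ae (Eventually.of_forall fun t => ?_)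
  change _ = UnitAddTorus.mFourier (-m) t • f (torusHomeomorph k t)
  rw [mFourier_eq_torusCharacter, smul_eq_mul, mul_comm]

/-- A continuous function with absolutely summable Fourier coefficients is the sum of its Fourier
series. -/
theorem hasSum_torusFourierCoeff {k : ℕ} {f : (Fin k → Circle) → ℂ} (hf : Continuous f)
    (hs : Summable fun m => ‖torusFourierCoeff f m‖) (z : Fin k → Circle) :
    HasSum (fun m => torusFourierCoeff f m * (torusCharacter m z : ℂ)) (f z) := by
  set g : C(UnitAddTorus (Fin k), ℂ) :=
    ⟨f ∘ torusHomeomorph k, hf.comp (torusHomeomorph k).continuous⟩ with hg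
  have hcoeff : ∀ m, UnitAddTorus.mFourierCoeff g m = torusFourierCoeff f m := fun m =>
    (torusFourierCoeff_eq_mFourierCoeff f m).symm
  have hgs : Summable (UnitAddTorus.mFourierCoeff g) := by
    refine Summable.of_norm (hs.congr fun m => ?_)
    rw [hcoeff]
  have h := UnitAddTorus.hasSum_mFourier_series_apply_of_summable hgs
    ((torusHomeomorph k).symm z)
  simp_rw [hcoeff, mFourier_eq_torusCharacter] at h
  simpa [hg] using h

theorem torusFourierCoeff_zero {k : ℕ} (f : (Fin k → Circle) → ℂ) :
    torusFourierCoeff f 0 = ∫ z, f z ∂(torusUniform k) := by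
  simp [torusFourierCoeff]

theorem integral_torusCharacter_eq_zero {k : ℕ} {m : Fin k → ℤ} (hm : m ≠ 0) :
    ∫ z, (torusCharacter m z : ℂ) ∂(torusUniform k) = 0 := by
  obtain ⟨j, hj⟩ := Function.ne_iff.mp hm
  simp_rw [coe_torusCharacter]
  rw [torusUniform,
    integral_fintype_prod_eq_prod (𝕜 := ℂ) (fun j (z : Circle) => ((z ^ m j : Circle) : ℂ))]
  exact Finset.prod_eq_zero (Finset.mem_univ j) (integral_circleUniform_zpow hj)

/-- The trigonometric polynomials are dense in the continuous functions on the torus. -/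
theorem exists_mem_span_torusCharacter_norm_sub_le {k : ℕ} {f : (Fin k → Circle) → ℂ}
    (hf : Continuous f) {δ : ℝ} (hδ : 0 < δ) :
    ∃ g ∈ Submodule.span ℂ (Set.range fun (m : Fin k → ℤ) z => (torusCharacter m z : ℂ)),
      ∀ z, ‖f z - g z‖ ≤ δ := by
  set F : C(UnitAddTorus (Fin k), ℂ) :=
    ⟨f ∘ torusHomeomorph k, hf.comp (torusHomeomorph k).continuous⟩ with hF
  have hmem : F ∈ closure (Submodule.span ℂ
      (Set.range (UnitAddTorus.mFourier (d := Fin k))) : Set C(UnitAddTorus (Fin k), ℂ)) := by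
    rw [← Submodule.topologicalClosure_coe, UnitAddTorus.span_mFourier_closure_eq_top]
    trivial
  obtain ⟨G, hG, hFG⟩ := Metric.mem_closure_iff.mp hmem δ hδ
  refine ⟨fun z => G ((torusHomeomorph k).symm z), ?_, fun z => ?_⟩
  · clear hFG
    induction hG using Submodule.span_induction with
    | mem G hG =>
      obtain ⟨m, rfl⟩ := hG
      refine Submodule.subset_span ⟨m, ?_⟩
      ext1 z
      simp [mFourier_eq_torusCharacter]
    | zero => exact Submodule.zero_mem _
    | add G G' _ _ h h' => exact Submodule.add_mem _ h h'
    | smul c G _ h => exact Submodule.smul_mem _ c h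
  · have := (ContinuousMap.dist_apply_le_dist (f := F) (g := G)
      ((torusHomeomorph k).symm z)).trans hFG.le
    rw [dist_eq_norm] at this
    simpa [hF] using this

/-! ### Empirical measures of a sequence with small character sums -/

theorem integral_empiricalMeasure (x : ℕ → Circle) (k N : ℕ) {f : (Fin k → Circle) → ℂ}
    (hf : Continuous f) :
    ∫ z, f z ∂(empiricalMeasure x k N) =
      (N : ℂ)⁻¹ * ∑ n ∈ Finset.Icc 1 N, f fun j => x (n + (j + 1)) := by
  rw [empiricalMeasure, integral_smul_measure, integral_finsetSum_measure fun n _ =>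
    integrable_dirac' hf.stronglyMeasurable (by simp)]
  simp_rw [integral_dirac' _ _ hf.stronglyMeasurable]
  simp

theorem norm_integral_empiricalMeasure_le (x : ℕ → Circle) (k N : ℕ) {f : (Fin k → Circle) → ℂ}
    {δ : ℝ} (hδ : 0 ≤ δ) (hf : ∀ z, ‖f z‖ ≤ δ) :
    ‖∫ z, f z ∂(empiricalMeasure x k N)‖ ≤ δ := by
  have hle : (empiricalMeasure x k N).real Set.univ ≤ 1 := by
    rcases Nat.eq_zero_or_pos N with rfl | hN
    · simp [empiricalMeasure]
    · simp [Measure.real, empiricalMeasure_apply_univ x k N hN]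
  refine (norm_integral_le_of_norm_le_const (Eventually.of_forall hf)).trans ?_
  exact mul_le_of_le_one_right hδ hle

theorem continuous_coe_torusCharacter {k : ℕ} (m : Fin k → ℤ) :
    Continuous fun z => (torusCharacter m z : ℂ) :=
  continuous_circle_coe.comp (continuous_torusCharacter m)

theorem norm_integral_torusCharacter_empiricalMeasure_le {x : ℕ → Circle} {k : ℕ} {u ε C : ℝ}
    (hC : ∀ m : Fin k → ℤ, m ≠ 0 → ∀ N : ℕ, 1 ≤ N →
      ‖∑ n ∈ Finset.Icc 1 N, (torusCharacter m (fun j => x (n + (j + 1))) : ℂ)‖ ≤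
        C * ‖m‖ ^ u * (N : ℝ) ^ (1 / 2 + ε)) {m : Fin k → ℤ} (hm : m ≠ 0) {N : ℕ} (hN : 1 ≤ N) :
    ‖∫ z, (torusCharacter m z : ℂ) ∂(empiricalMeasure x k N)‖ ≤
      C * ‖m‖ ^ u * (N : ℝ) ^ (-(1 / 2 : ℝ) + ε) := by
  have hN0 : (0 : ℝ) < N := by exact_mod_cast hN
  rw [integral_empiricalMeasure x k N (continuous_coe_torusCharacter m), norm_mul, norm_inv,
    Complex.norm_natCast, inv_mul_le_iff₀ hN0]
  refine (hC m hm N hN).trans_eq ?_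
  rw [show (1 / 2 + ε : ℝ) = 1 + (-(1 / 2 : ℝ) + ε) by ring, Real.rpow_add hN0, Real.rpow_one]
  ring

theorem tendsto_integral_torusCharacter {x : ℕ → Circle} {k : ℕ} {u ε : ℝ} (hε : ε < 1 / 2)
    (h : HasCharacterSumBound x k u ε) (m : Fin k → ℤ) :
    Tendsto (fun N => ∫ z, (torusCharacter m z : ℂ) ∂(empiricalMeasure x k N)) atTop
      (𝓝 (∫ z, (torusCharacter m z : ℂ) ∂(torusUniform k))) := by
  rcases eq_or_ne m 0 with rfl | hm
  · refine tendsto_const_nhds.congr' ?_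
    filter_upwards [eventually_ge_atTop 1] with N hN
    simp [torusCharacter, Measure.real, empiricalMeasure_apply_univ x k N hN]
  · obtain ⟨C, hC⟩ := h
    rw [integral_torusCharacter_eq_zero hm]
    have hlim : Tendsto (fun N : ℕ => C * ‖m‖ ^ u * (N : ℝ) ^ (-(1 / 2 : ℝ) + ε)) atTop (𝓝 0) := by
      rw [show -(1 / 2 : ℝ) + ε = -(1 / 2 - ε) by ring, ← mul_zero (C * ‖m‖ ^ u)]
      exact ((tendsto_rpow_neg_atTop (by linarith)).comp
        tendsto_natCast_atTop_atTop).const_mul _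
    refine squeeze_zero_norm' ?_ hlim
    filter_upwards [eventually_ge_atTop 1] with N hN
    exact norm_integral_torusCharacter_empiricalMeasure_le hC hm hN

/-- Convergence of the integrals of all characters implies convergence of the integrals of all
continuous functions. -/
theorem tendsto_integral_of_tendsto_integral_torusCharacter {x : ℕ → Circle} {k : ℕ}
    (h : ∀ m : Fin k → ℤ,
      Tendsto (fun N => ∫ z, (torusCharacter m z : ℂ) ∂(empiricalMeasure x k N)) atTop
        (𝓝 (∫ z, (torusCharacter m z : ℂ) ∂(torusUniform k))))
    {f : (Fin k → Circle) → ℂ} (hf : Continuous f) :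
    Tendsto (fun N => ∫ z, f z ∂(empiricalMeasure x k N)) atTop
      (𝓝 (∫ z, f z ∂(torusUniform k))) := by
  have hint : ∀ {g : (Fin k → Circle) → ℂ}, Continuous g → ∀ μ : Measure (Fin k → Circle),
      IsFiniteMeasure μ → Integrable g μ := fun hg μ _ =>
    integrableOn_univ.mp (hg.continuousOn.integrableOn_compact isCompact_univ)
  have hspan : ∀ g ∈ Submodule.span ℂ
      (Set.range fun (m : Fin k → ℤ) z => (torusCharacter m z : ℂ)),
      Continuous g ∧ Tendsto (fun N => ∫ z, g z ∂(empiricalMeasure x k N)) atTop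
        (𝓝 (∫ z, g z ∂(torusUniform k))) := by
    intro g hg
    induction hg using Submodule.span_induction with
    | mem g hg =>
      obtain ⟨m, rfl⟩ := hg
      exact ⟨continuous_coe_torusCharacter m, h m⟩
    | zero =>
      refine ⟨continuous_const, ?_⟩
      simp only [Pi.zero_apply, integral_zero]
      exact tendsto_const_nhds
    | add g g' _ _ hg hg' =>
      refine ⟨hg.1.add hg'.1, ?_⟩
      simp only [Pi.add_apply]
      rw [integral_add (hint hg.1 _ inferInstance) (hint hg'.1 _ inferInstance)]
      refine (hg.2.add hg'.2).congr fun N => ?_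
      rw [integral_add (hint hg.1 _ inferInstance) (hint hg'.1 _ inferInstance)]
    | smul c g _ hg =>
      refine ⟨hg.1.const_smul c, ?_⟩
      simp only [Pi.smul_apply, integral_smul]
      exact hg.2.const_smul c
  rw [Metric.tendsto_atTop]
  intro δ hδ
  obtain ⟨g, hg, hfg⟩ := exists_mem_span_torusCharacter_norm_sub_le hf
    (show 0 < δ / 4 by positivity)
  obtain ⟨hgc, hgt⟩ := hspan g hg
  obtain ⟨N₀, hN₀⟩ := Metric.tendsto_atTop.mp hgt (δ / 4) (by positivity)
  refine ⟨N₀, fun N hN => ?_⟩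
  have h1 := norm_integral_empiricalMeasure_le x k N (by positivity) hfg
  have h2 : ‖∫ z, (f z - g z) ∂(torusUniform k)‖ ≤ δ / 4 := by
    simpa using norm_integral_le_of_norm_le_const (μ := torusUniform k) (Eventually.of_forall hfg)
  rw [integral_sub (hint hf _ inferInstance) (hint hgc _ inferInstance), ← dist_eq_norm] at h1 h2
  rw [dist_comm] at h2
  have h3 := dist_triangle4 (∫ z, f z ∂(empiricalMeasure x k N))
    (∫ z, g z ∂(empiricalMeasure x k N)) (∫ z, g z ∂(torusUniform k))
    (∫ z, f z ∂(torusUniform k))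
  linarith [hN₀ N hN]

/-- A seminorm on `ℝ ^ k` that vanishes only at `0` dominates a multiple of the supremum norm. -/
theorem Seminorm.exists_pos_forall_mul_norm_le {k : ℕ} (p : Seminorm ℝ (Fin k → ℝ))
    (hp : ∀ v, p v = 0 → v = 0) : ∃ c : ℝ, 0 < c ∧ ∀ v, c * ‖v‖ ≤ p v := by
  have hcont : Continuous p := continuousOn_univ.mp
    (ConvexOn.continuousOn isOpen_univ p.convexOn)
  rcases (Metric.sphere (0 : Fin k → ℝ) 1).eq_empty_or_nonempty with he | hne
  · refine ⟨1, one_pos, fun v => ?_⟩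
    have hv : v = 0 := by
      by_contra h
      have : ‖v‖⁻¹ • v ∈ Metric.sphere (0 : Fin k → ℝ) 1 := by
        rw [mem_sphere_zero_iff_norm, norm_smul, norm_inv, norm_norm,
          inv_mul_cancel₀ (norm_ne_zero_iff.mpr h)]
      simp [he] at this
    simp [hv]
  obtain ⟨v₀, hv₀, hmin⟩ := (isCompact_sphere (0 : Fin k → ℝ) 1).exists_isMinOn hne
    hcont.continuousOn
  rw [mem_sphere_zero_iff_norm] at hv₀
  refine ⟨p v₀, lt_of_le_of_ne (apply_nonneg p v₀) fun h => ?_, fun v => ?_⟩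
  · rw [hp v₀ h.symm, norm_zero] at hv₀
    exact zero_ne_one hv₀
  · rcases eq_or_ne v 0 with rfl | hv
    · simp
    have hn : 0 < ‖v‖ := norm_pos_iff.mpr hv
    have hmem : ‖v‖⁻¹ • v ∈ Metric.sphere (0 : Fin k → ℝ) 1 := by
      rw [mem_sphere_zero_iff_norm, norm_smul, norm_inv, norm_norm, inv_mul_cancel₀ hn.ne']
    have := hmin hmem
    rw [Set.mem_ofPred_eq, map_smul_eq_mul, norm_inv, norm_norm, le_inv_mul_iff₀ hn] at this
    rwa [mul_comm]

theorem one_le_norm_of_ne_zero {k : ℕ} {m : Fin k → ℤ} (hm : m ≠ 0) : 1 ≤ ‖m‖ := by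
  obtain ⟨j, hj⟩ := Function.ne_iff.mp hm
  refine le_trans ?_ (norm_le_pi_norm m j)
  rw [Int.norm_eq_abs]
  exact_mod_cast Int.one_le_abs hj

/-- Integrating the Fourier series of `f` term by term bounds the error by
`∑ m, |f̂ m| * C * ‖m‖ ^ u * N ^ (-1/2 + ε)`. -/
theorem isBigO_integral_sub_of_hasCharacterSumBound {x : ℕ → Circle} {k : ℕ} {u ε : ℝ}
    (h : HasCharacterSumBound x k u ε) (hu : 0 < u) {p : Seminorm ℝ (Fin k → ℝ)}
    (hp : ∀ v, p v = 0 → v = 0) {f : (Fin k → Circle) → ℂ} (hf : Continuous f)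
    (hs : Summable fun m : Fin k → ℤ => ‖torusFourierCoeff f m‖ * p (fun j => (m j : ℝ)) ^ u) :
    (fun N : ℕ => (∫ z, f z ∂(empiricalMeasure x k N)) - ∫ z, f z ∂(torusUniform k))
      =O[atTop] fun N : ℕ => (N : ℝ) ^ (-(1 / 2 : ℝ) + ε) := by
  obtain ⟨c, hc, hcp⟩ := p.exists_pos_forall_mul_norm_le hp
  obtain ⟨C, hC⟩ := h
  have hcu : 0 < c ^ u := Real.rpow_pos_of_pos hc u
  have hsum : Summable fun m : Fin k → ℤ => ‖torusFourierCoeff f m‖ * ‖m‖ ^ u := by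
    refine Summable.of_nonneg_of_le (fun m => by positivity) (fun m => ?_) (hs.mul_left (c ^ u)⁻¹)
    rw [le_inv_mul_iff₀ hcu, mul_left_comm, ← Real.mul_rpow hc.le (norm_nonneg m)]
    gcongr
    rw [← norm_intCast_comp]
    exact hcp _
  -- Away from `m = 0` the weight `‖m‖ ^ u` is at least `1`.
  have hsum1 : Summable fun m : Fin k → ℤ => ‖torusFourierCoeff f m‖ := by
    refine Summable.of_norm_bounded_eventually hsum ?_
    refine (Set.finite_singleton (0 : Fin k → ℤ)).subset fun m hm => ?_
    by_contra hm0
    refine hm ?_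
    rw [Set.mem_ofPred_eq, norm_norm]
    exact le_mul_of_one_le_right (norm_nonneg _)
      (Real.one_le_rpow (one_le_norm_of_ne_zero hm0) hu.le)
  refine IsBigO.of_bound (∑' m : Fin k → ℤ, ‖torusFourierCoeff f m‖ * ‖m‖ ^ u * C) ?_
  filter_upwards [eventually_ge_atTop 1] with N hN
  have hN0 : (0 : ℝ) < N := by exact_mod_cast hN
  set a := fun m : Fin k → ℤ =>
    torusFourierCoeff f m * ∫ z, (torusCharacter m z : ℂ) ∂(empiricalMeasure x k N) with ha
  have hexp : HasSum a (∫ z, f z ∂(empiricalMeasure x k N)) := by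
    rw [integral_empiricalMeasure x k N hf]
    have := (hasSum_sum fun n (_ : n ∈ Finset.Icc 1 N) =>
      hasSum_torusFourierCoeff hf hsum1 fun j => x (n + (j + 1))).mul_left (N : ℂ)⁻¹
    refine this.congr_fun fun m => ?_
    rw [ha]
    simp only
    rw [integral_empiricalMeasure x k N (continuous_coe_torusCharacter m), ← Finset.mul_sum]
    ring
  have ha0 : a 0 = ∫ z, f z ∂(torusUniform k) := by
    rw [ha]
    simp [torusFourierCoeff_zero, torusCharacter, Measure.real,
      empiricalMeasure_apply_univ x k N hN]
  -- The frequency `m = 0` contributes exactly the integral of `f` over the torus.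
  have hdiff := hexp.sub (hasSum_ite_eq (0 : Fin k → ℤ) (a 0))
  rw [ha0] at hdiff
  rw [← hdiff.tsum_eq, Real.norm_of_nonneg (by positivity), ← tsum_mul_right]
  refine tsum_of_norm_bounded ((hsum.mul_right C).mul_right _).hasSum fun m => ?_
  rcases eq_or_ne m 0 with rfl | hm
  · rw [if_pos rfl, ← ha0, sub_self, norm_zero, norm_zero, Real.zero_rpow hu.ne', mul_zero,
      zero_mul, zero_mul]
  · rw [if_neg hm, sub_zero, ha, norm_mul]
    refine (mul_le_mul_of_nonneg_left
      (norm_integral_torusCharacter_empiricalMeasure_le hC hm hN) (norm_nonneg _)).trans_eq ?_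
    ring

theorem HasCharacterSumBound.mono {x : ℕ → Circle} {k : ℕ} {u u' ε ε' : ℝ}
    (h : HasCharacterSumBound x k u ε) (hu : u ≤ u') (hε : ε ≤ ε') :
    HasCharacterSumBound x k u' ε' := by
  obtain ⟨C, hC⟩ := h
  refine ⟨|C|, fun m hm N hN => (hC m hm N hN).trans ?_⟩
  have h1 := one_le_norm_of_ne_zero hm
  have h2 : (1 : ℝ) ≤ N := by exact_mod_cast hN
  gcongr
  exact le_abs_self C

theorem mainTheorem3 {Ω : Type*} [MeasurableSpace Ω] (P : Measure Ω) [IsProbabilityMeasure P]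
    (X : ℕ → Ω → Circle) (hX : IsUniformRandomMultiplicative P X) (k : ℕ) (hk : 1 ≤ k) :
    ∀ᵐ ω ∂P,
      Tendsto (β := FiniteMeasure (Fin k → Circle))
        (fun N : ℕ => ⟨empiricalMeasure (fun n => X n ω) k N, inferInstance⟩)
        atTop (𝓝 ⟨torusUniform k, inferInstance⟩) ∧
      ∀ u : ℝ, (k : ℝ) / 2 < u →
      ∀ normk : Seminorm ℝ (Fin k → ℝ), (∀ v, normk v = 0 → v = 0) →
      ∀ f : (Fin k → Circle) → ℂ, Continuous f →
        (Summable fun m : Fin k → ℤ =>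
          ‖torusFourierCoeff f m‖ * normk (fun j => (m j : ℝ)) ^ u) →
      ∀ ε : ℝ, 0 < ε →
        (fun N : ℕ => (∫ z, f z ∂(empiricalMeasure (fun n => X n ω) k N))
            - ∫ z, f z ∂(torusUniform k))
          =O[atTop] fun N : ℕ => (N : ℝ) ^ (-(1 / 2 : ℝ) + ε) := by
  -- Countably many pairs `(u, ε)` suffice, as the bound weakens when `u` and `ε` grow.
  have hall : ∀ᵐ ω ∂P, ∀ q : ℕ, HasCharacterSumBound (fun n => X n ω) k
      ((k : ℝ) / 2 + 1 / (q + 1)) (1 / (q + 1)) :=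
    ae_all_iff.mpr fun q => hX.ae_hasCharacterSumBound k
      (lt_add_of_pos_right _ Nat.one_div_pos_of_nat) Nat.one_div_pos_of_nat
  filter_upwards [hall] with ω hω
  have hbound : ∀ u : ℝ, (k : ℝ) / 2 < u → ∀ ε : ℝ, 0 < ε →
      HasCharacterSumBound (fun n => X n ω) k u ε := by
    intro u hu ε hε
    obtain ⟨q, hq⟩ := exists_nat_one_div_lt (lt_min (sub_pos.mpr hu) hε)
    rw [lt_min_iff] at hq
    exact (hω q).mono (by linarith [hq.1]) hq.2.le
  refine ⟨?_, fun u hu normk hnorm f hf hs ε hε =>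
    isBigO_integral_sub_of_hasCharacterSumBound (hbound u hu ε hε)
      (lt_of_le_of_lt (by positivity) hu) hnorm hf hs⟩
  refine (FiniteMeasure.tendsto_iff_forall_integral_rclike_tendsto ℂ).mpr fun f => ?_
  exact tendsto_integral_of_tendsto_integral_torusCharacter
    (tendsto_integral_torusCharacter (u := (k : ℝ) / 2 + 1) (ε := 1 / 4) (by norm_num)
      (hbound _ (by linarith) _ (by norm_num))) f.continuous
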